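/- Let $r\in\{0,1,2,\dots\}\cup\{\infty\}$. All manifolds are Hausdorff, second countable and without boundary. A \emph{$C^r$ foliation} $\mathcal F$ of dimension $p$ and codimension $q$ on a $C^r$ manifold $M$ of dimension $p+q$ is a maximal collection of $C^r$ charts $\theta:U\to T\times B$ of $M$ (\emph{foliation charts}) whose domains cover $M$, where $T\subset\mathbb R^q$ is open and $B\subset\mathbb R^p$ is open and convex, and whose changes of coordinates are locally of the form $(x,y)\mapsto(h(x),g(x,y))$. The fibres of the local projections $\pi:U\xrightarrow{\theta}T\times B\to T$ are called \emph{plaques}; the plaques generate the \emph{leaf topology} on $M$, and its connected components are the \emph{leaves} of $\mathcal F$. Let $\mathcal F$ and $\mathcal F'$ be $C^r$ foliations, of arbitrary dimensions and codimensions, on $C^r$ manifolds $M$ and $M'$, and let $C^r(\mathcal F,\mathcal F')$ be the set of $C^r$ maps $M\to M'$ that map each leaf of $\mathcal F$ into a leaf of $\mathcal F'$. Consider $\phi\in C^r(\mathcal F,\mathcal F')$, a locally finite family $\Theta=\{U_i,\theta_i\}$ of foliation charts of $\mathcal F$, and, with the same index set, a family $\Theta'=\{U'_i,\theta'_i\}$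 of foliation charts of $\mathcal F'$ with local projections $\pi'_i$, a family $\mathcal K=\{K_i\}$ of compact sets with $K_i\subset U_i$ and $\phi(K_i)\subset U'_i$, and a family $\mathcal E=\{\epsilon_i\}$ of positive numbers. For $s\in\{0,1,2,\dots\}$ with $s\le r$, let $\mathcal N^s(\phi,\Theta,\Theta',\mathcal K,\mathcal E)$ be the set of all $\psi\in C^r(\mathcal F,\mathcal F')$ such that, for all $i$, all $x\in K_i$ and all $k\in\{0,\dots,s\}$, $$\psi(K_i)\subset U'_i,\qquad \pi'_i(\psi(x))=\pi'_i(\phi(x)),$$ $$\left\|D^k(\theta'_i\circ\psi\circ\theta_i^{-1})(\theta_i(x))-D^k(\theta'_i\circ\phi\circ\theta_i^{-1})(\theta_i(x))\right\|<\epsilon_i .$$ The \emph{strong plaquewise topology} on $C^r(\mathcal F,\mathcal F')$ is the topology generated by all sets $\mathcal N^s(\phi,\Theta,\Theta',\mathcal K,\mathcal E)$, with $s=r$ if $r<\infty$ and with $s$ an arbitrary natural number if $r=\infty$. The \emph{weak plaquewise topology} is the topology generated by those of these sets that are given by finite families. \textbf{Theorem.} For $0\le r\le\infty$, the set $C^r(\mathcal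 F,\mathcal F')$ is a Baire space (every countable intersection of dense open subsets is dense) both with the weak plaquewise topology and with the strong plaquewise topology. -/

import Mathlib

open scoped Manifold ContDiff Topology

noncomputable section

/-- Euclidean space `ℝⁿ`. -/
abbrev Euc (n : ℕ) : Type := EuclideanSpace ℝ (Fin n)

/-- The change of coordinates `e₂ ∘ e₁⁻¹` has, around every point of its domain
`e₁ (U₁ ∩ U₂)`, the form `(x, y) ↦ (h x, g (x, y))`. -/
def FoliatedTransition {p q : ℕ} {M : Type*} [TopologicalSpace M]
    (e₁ e₂ : OpenPartialHomeomorph M (Euc q × Euc p)) : Prop :=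
  ∀ z ∈ (e₁.symm.trans e₂).source,
    ∃ h : Euc q → Euc q, ∀ᶠ w in 𝓝 z, (e₂ (e₁.symm w)).1 = h w.1

/-- A homeomorphism `θ` of an open set `U ⊆ M` onto a product `T × B`, with `T` open in `ℝ^q` and
`B` convex and open in `ℝ^p`, which together with its inverse is of class `C^r` for the given
`C^r` structure of `M`. -/
structure IsProductChart (r : ℕ∞) {p q : ℕ} {M : Type*} [TopologicalSpace M]
    [ChartedSpace (Euc (p + q)) M] (e : OpenPartialHomeomorph M (Euc q × Euc p)) : Prop where
  target_eq : ∃ (T : Set (Euc q)) (B : Set (Euc p)),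
    IsOpen T ∧ IsOpen B ∧ Convex ℝ B ∧ e.target = T ×ˢ B
  contMDiffOn : ContMDiffOn 𝓘(ℝ, Euc (p + q)) 𝓘(ℝ, Euc q × Euc p) r e e.source
  contMDiffOn_symm : ContMDiffOn 𝓘(ℝ, Euc q × Euc p) 𝓘(ℝ, Euc (p + q)) r e.symm e.target

/-- A `C^r` foliation of dimension `p` and codimension `q` on the `C^r` manifold `M`:
a maximal `C^r` foliation atlas. -/
structure Foliation (r : ℕ∞) (p q : ℕ) (M : Type*) [TopologicalSpace M]
    [ChartedSpace (Euc (p + q)) M] where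
  /-- the foliation charts -/
  charts : Set (OpenPartialHomeomorph M (Euc q × Euc p))
  isProductChart : ∀ e ∈ charts, IsProductChart r e
  covers : ∀ x : M, ∃ e ∈ charts, x ∈ e.source
  compatible : ∀ e₁ ∈ charts, ∀ e₂ ∈ charts, FoliatedTransition e₁ e₂
  maximal : ∀ e, IsProductChart r e →
    (∀ e' ∈ charts, FoliatedTransition e e' ∧ FoliatedTransition e' e) → e ∈ charts

namespace Foliation

variable {r : ℕ∞} {p q : ℕ} {M : Type*} [TopologicalSpace M] [ChartedSpace (Euc (p + q)) M]

/-- The plaques: the fibres of the local projections `U → T` of the foliation charts. -/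
def plaques (F : Foliation r p q M) : Set (Set M) :=
  {P | ∃ e ∈ F.charts, ∃ t ∈ Prod.fst '' e.target, P = {x ∈ e.source | (e x).1 = t}}

/-- The leaf topology, generated by the plaques. -/
@[reducible] def leafTopology (F : Foliation r p q M) : TopologicalSpace M :=
  TopologicalSpace.generateFrom F.plaques

/-- The leaf through `x`: the connected component of `x` in the leaf topology. -/
def leaf (F : Foliation r p q M) (x : M) : Set M :=
  @connectedComponent M F.leafTopology x

end Foliation

section Maps

variable {r : ℕ∞} {p q p' q' : ℕ}
  {M : Type*} [TopologicalSpace M] [ChartedSpace (Euc (p + q)) M]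
  {M' : Type*} [TopologicalSpace M'] [ChartedSpace (Euc (p' + q')) M']

/-- `C^r(F, F')`: the `C^r` maps `M → M'` that map leaves of `F` into leaves of `F'`. -/
def FoliationMap (F : Foliation r p q M) (F' : Foliation r p' q' M') : Type _ :=
  {φ : M → M' // ContMDiff 𝓘(ℝ, Euc (p + q)) 𝓘(ℝ, Euc (p' + q')) r φ ∧
    ∀ x, φ '' F.leaf x ⊆ F'.leaf (φ x)}

/-- The data `(Θ, Θ', 𝓚, 𝓔)`, indexed by `ι`, used to define a basic neighbourhood of `φ`. -/
structure PlaqueData {F : Foliation r p q M} {F' : Foliation r p' q' M'}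
    (φ : FoliationMap F F') (ι : Type) where
  θ : ι → OpenPartialHomeomorph M (Euc q × Euc p)
  θ' : ι → OpenPartialHomeomorph M' (Euc q' × Euc p')
  K : ι → Set M
  ε : ι → ℝ
  θ_mem : ∀ i, θ i ∈ F.charts
  locallyFinite : LocallyFinite fun i => (θ i).source
  θ'_mem : ∀ i, θ' i ∈ F'.charts
  isCompact : ∀ i, IsCompact (K i)
  K_subset : ∀ i, K i ⊆ (θ i).source
  mapsTo : ∀ i, Set.MapsTo φ.1 (K i) (θ' i).source
  ε_pos : ∀ i, 0 < ε i

/-- The set of all `ψ ∈ C^r(F, F')` such that, for all `i` and all `x ∈ K i`: `ψ x` lies in the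
domain of `θ' i`, `ψ x` and `φ x` lie in the same plaque of `θ' i`, and the derivatives of order
`0, …, s` of the local expressions of `ψ` and `φ` at `θ i x` are `ε i`-close. -/
def PlaqueData.nhd {F : Foliation r p q M} {F' : Foliation r p' q' M'}
    {φ : FoliationMap F F'} {ι : Type} (D : PlaqueData φ ι) (s : ℕ) : Set (FoliationMap F F') :=
  {ψ | ∀ i, ∀ x ∈ D.K i,
    ψ.1 x ∈ (D.θ' i).source ∧
    (D.θ' i (ψ.1 x)).1 = (D.θ' i (φ.1 x)).1 ∧
    ∀ k ≤ s,
      ‖iteratedFDeriv ℝ k (D.θ' i ∘ ψ.1 ∘ (D.θ i).symm) (D.θ i x) -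
        iteratedFDeriv ℝ k (D.θ' i ∘ φ.1 ∘ (D.θ i).symm) (D.θ i x)‖ < D.ε i}

/-- The strong plaquewise topology on `C^r(F, F')`. The order `s` of the derivatives is `r` if `r`
is finite, and any natural number if `r = ∞`. -/
@[reducible] def strongPlaquewise (F : Foliation r p q M) (F' : Foliation r p' q' M') :
    TopologicalSpace (FoliationMap F F') :=
  TopologicalSpace.generateFrom
    {N | ∃ (s : ℕ) (φ : FoliationMap F F') (ι : Type) (D : PlaqueData φ ι),
      ((s : ℕ∞) = r ∨ r = ⊤) ∧ N = D.nhd s}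

/-- The weak plaquewise topology on `C^r(F, F')`: as the strong one, with finite families. -/
@[reducible] def weakPlaquewise (F : Foliation r p q M) (F' : Foliation r p' q' M') :
    TopologicalSpace (FoliationMap F F') :=
  TopologicalSpace.generateFrom
    {N | ∃ (s : ℕ) (φ : FoliationMap F F') (ι : Type) (_ : Finite ι) (D : PlaqueData φ ι),
      ((s : ℕ∞) = r ∨ r = ⊤) ∧ N = D.nhd s}

end Maps

end

/-! The proof is a completeness argument without a metric: the limit is taken in a weak sense and
then shown to stay in the open sets chosen. Given dense open sets `A n` and an open set `U`, choose
maps φₙ and open sets Vₙ decreasing from `U`. Each φₙ₊₁ lies in Vₙ ∩ `A n`, in the plaques of φₙ and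
with derivatives within (1/2)ⁿ of those of φₙ, on finitely many compact sets collected so far. These
sets come to cover the n-th term of a compact exhaustion of `M`.

Two facts then suffice. By `exists_jetTendsto`, the maps φₙ converge, jet by jet at every point, to
some ψ in C^r(F, F'): derivatives are locally uniformly Cauchy, and eventually constant plaques make
ψ preserve leaves. By `exists_isOpen_jetTendsto_mem`, each Vₙ₊₁ can be chosen so small that such
limits of sequences eventually in it stay in Vₙ ∩ `A n`; the conditions defining basic sets are
pointwise, hence survive pointwise limits once strict inequalities are given a margin. Convergence
in the strong topology is never needed.

Only finite families are used to make the sequence converge, so one proof serves both topologies;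
they differ only in the index types admitted (`IndexClass`). -/

open Filter Set

/-! ### Convergence of jets, composition and uniform limits of derivatives. -/

section Analysis

variable {E F G H : Type*} [NormedAddCommGroup E] [NormedSpace ℝ E] [NormedAddCommGroup F]
  [NormedSpace ℝ F] [NormedAddCommGroup G] [NormedSpace ℝ G] [NormedAddCommGroup H]
  [NormedSpace ℝ H]

/-- By the Faà di Bruno formula, each term is a finite sum of expressions continuous in the
coefficients of order at most n. -/
theorem tendsto_taylorComp {ι : Type*} {l : Filter ι} {q : ι → FormalMultilinearSeries ℝ F G}
    {q₀ : FormalMultilinearSeries ℝ F G} {p : ι → FormalMultilinearSeries ℝ E F}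
    {p₀ : FormalMultilinearSeries ℝ E F} {n : ℕ}
    (hq : ∀ k ≤ n, Tendsto (fun a => q a k) l (𝓝 (q₀ k)))
    (hp : ∀ k ≤ n, Tendsto (fun a => p a k) l (𝓝 (p₀ k))) :
    Tendsto (fun a => (q a).taylorComp (p a) n) l (𝓝 (q₀.taylorComp p₀ n)) := by
  unfold FormalMultilinearSeries.taylorComp
  refine tendsto_finsetSum _ fun c _ => ?_
  have h1 := ((c.compAlongOrderedFinpartitionL ℝ E F G).continuous.tendsto _).comp
    (hq c.length c.length_le)
  have h2 : Tendsto (fun a => fun i => p a (c.partSize i)) l (𝓝 fun i => p₀ (c.partSize i)) :=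
    tendsto_pi_nhds.2 fun i => hp _ (c.partSize_le i)
  have hc : Continuous fun x : ContinuousMultilinearMap ℝ
      (fun i : Fin c.length => E [×c.partSize i]→L[ℝ] F) (E [×n]→L[ℝ] G) ×
      (∀ i : Fin c.length, E [×c.partSize i]→L[ℝ] F) => x.1 x.2 := by fun_prop
  exact (hc.tendsto (_, _)).comp (h1.prodMk_nhds h2)

/-- Convergence of jets at a point is preserved by composition with fixed smooth maps. -/
theorem tendsto_iteratedFDeriv_comp_comp {ι : Type*} {l : Filter ι} {f : ι → E → F} {f₀ : E → F}
    {g : F → G} {h : H → E} {z : H} {n : ℕ}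
    (hg : ContDiffAt ℝ n g (f₀ (h z))) (hh : ContDiffAt ℝ n h z)
    (hf : ∀ᶠ a in l, ContDiffAt ℝ n (f a) (h z)) (hf₀ : ContDiffAt ℝ n f₀ (h z))
    (hlim : ∀ k ≤ n, Tendsto (fun a => iteratedFDeriv ℝ k (f a) (h z)) l
      (𝓝 (iteratedFDeriv ℝ k f₀ (h z)))) :
    Tendsto (fun a => iteratedFDeriv ℝ n (g ∘ f a ∘ h) z) l
      (𝓝 (iteratedFDeriv ℝ n (g ∘ f₀ ∘ h) z)) := by
  have hval : Tendsto (fun a => f a (h z)) l (𝓝 (f₀ (h z))) := by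
    have := ((continuousMultilinearCurryFin0 ℝ E F).continuous.tendsto _).comp
      (hlim 0 (Nat.zero_le _))
    simpa [Function.comp_def, iteratedFDeriv_zero_eq_comp] using this
  -- The derivatives of g are taken at the moving points f a (h z); since n is finite, being C^n at
  -- a point is an open condition.
  have hgev : ∀ᶠ a in l, ContDiffAt ℝ n g (f a (h z)) :=
    hval.eventually (hg.eventually (by simp))
  have key : ∀ k ≤ n, Tendsto (fun a => iteratedFDeriv ℝ k (g ∘ f a) (h z)) l
      (𝓝 (iteratedFDeriv ℝ k (g ∘ f₀) (h z))) := by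
    intro k hk
    have hk' : (k : ℕ∞ω) ≤ n := by exact_mod_cast hk
    rw [iteratedFDeriv_comp hg hf₀ hk']
    refine Tendsto.congr' (f₁ := fun a => (ftaylorSeries ℝ g (f a (h z))).taylorComp
      (ftaylorSeries ℝ (f a) (h z)) k) ?_ (tendsto_taylorComp (fun j hj => ?_)
        fun j hj => hlim j (hj.trans hk))
    · filter_upwards [hgev, hf] with a ha hfa
      rw [iteratedFDeriv_comp ha hfa hk']
    · have hc : ContinuousAt (iteratedFDeriv ℝ j g) (f₀ (h z)) :=
        (hg.of_le (by exact_mod_cast hj.trans hk) : ContDiffAt ℝ j g _).iteratedFDeriv_right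
          (m := 0) (i := j) (by simp) |>.continuousAt
      exact hc.tendsto.comp hval
  have e₀ : iteratedFDeriv ℝ n (g ∘ f₀ ∘ h) z = _ :=
    iteratedFDeriv_comp (f := h) (g := g ∘ f₀) (hg.comp (h z) hf₀) hh le_rfl
  rw [e₀]
  refine Tendsto.congr' (f₁ := fun a => (ftaylorSeries ℝ (g ∘ f a) (h z)).taylorComp
      (ftaylorSeries ℝ h z) n) ?_ (tendsto_taylorComp key fun j hj => tendsto_const_nhds)
  filter_upwards [hgev, hf] with a ha hfa
  exact (iteratedFDeriv_comp (f := h) (g := g ∘ f a) (ha.comp (h z) hfa) hh le_rfl).symm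

/-- The tail of the geometric series bounds the distance to the limit independently of the point of
O. -/
theorem exists_tendstoUniformlyOn_of_dist_le_geometric {X Y : Type*} [PseudoMetricSpace Y]
    [CompleteSpace Y] {u : ℕ → X → Y} {O : Set X}
    (h : ∀ᶠ m in atTop, ∀ z ∈ O, dist (u m z) (u (m + 1) z) ≤ (1 / 2 : ℝ) ^ m) :
    ∃ v : X → Y, TendstoUniformlyOn u v atTop O := by
  obtain ⟨N, hN⟩ := eventually_atTop.1 h
  have hb : ∀ z ∈ O, ∀ n, dist (u (n + N) z) (u (n + 1 + N) z) ≤ 1 * (1 / 2 : ℝ) ^ n := by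
    intro z hz n
    have := hN (n + N) (Nat.le_add_left _ _) z hz
    rw [show n + 1 + N = n + N + 1 by ring, one_mul]
    exact this.trans (pow_le_pow_of_le_one (by norm_num) (by norm_num) (Nat.le_add_right _ _))
  have hl : ∀ z, ∃ y, z ∈ O → Tendsto (fun n => u (n + N) z) atTop (𝓝 y) := by
    intro z
    by_cases hz : z ∈ O
    · obtain ⟨y, hy⟩ := cauchySeq_tendsto_of_complete
        (cauchySeq_of_le_geometric (f := fun n => u (n + N) z) (1 / 2) 1 (by norm_num) (hb z hz))
      exact ⟨y, fun _ => hy⟩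
    · exact ⟨u 0 z, fun h => absurd h hz⟩
  choose v hv using hl
  refine ⟨v, Metric.tendstoUniformlyOn_iff.2 fun ε hε => ?_⟩
  have h0 : Tendsto (fun n : ℕ => 1 * (1 / 2 : ℝ) ^ n / (1 - 1 / 2)) atTop (𝓝 0) := by
    simpa using ((tendsto_pow_atTop_nhds_zero_of_lt_one (r := (1 / 2 : ℝ)) (by norm_num)
      (by norm_num)).const_mul 1).div_const (1 - 1 / 2 : ℝ)
  obtain ⟨n₀, hn₀⟩ := eventually_atTop.1 (h0.eventually (gt_mem_nhds hε))
  filter_upwards [eventually_ge_atTop (n₀ + N)] with n hn z hz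
  have hd := dist_le_of_le_geometric_of_tendsto (f := fun n => u (n + N) z) (1 / 2) 1
    (by norm_num) (hb z hz) (hv z hz) (n - N)
  simp only [show n - N + N = n by omega] at hd
  rw [dist_comm]
  exact hd.trans_lt (hn₀ (n - N) (by omega))

/-- A sequence of `C^r` maps whose derivatives up to order `r` are uniformly geometrically Cauchy
has a `C^r` limit, and the derivatives converge to those of the limit. -/
theorem contDiffOn_of_dist_iteratedFDeriv_le_geometric [CompleteSpace F] {r : ℕ∞} {O : Set E}
    (hO : IsOpen O) {f : ℕ → E → F} {g : E → F} (hf : ∀ᶠ m in atTop, ContDiffOn ℝ r (f m) O)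
    (hfg : ∀ z ∈ O, Tendsto (fun m => f m z) atTop (𝓝 (g z)))
    (hd : ∀ k : ℕ, (k : ℕ∞) ≤ r → ∀ᶠ m in atTop, ∀ z ∈ O,
      dist (iteratedFDeriv ℝ k (f m) z) (iteratedFDeriv ℝ k (f (m + 1)) z) ≤ (1 / 2 : ℝ) ^ m) :
    ContDiffOn ℝ r g O ∧ ∀ k : ℕ, (k : ℕ∞) ≤ r → ∀ z ∈ O,
      Tendsto (fun m => iteratedFDeriv ℝ k (f m) z) atTop (𝓝 (iteratedFDeriv ℝ k g z)) := by
  have hv : ∀ k : ℕ, ∃ v : E → (E [×k]→L[ℝ] F), (k : ℕ∞) ≤ r →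
      TendstoUniformlyOn (fun m => iteratedFDeriv ℝ k (f m)) v atTop O := by
    intro k
    by_cases hk : (k : ℕ∞) ≤ r
    · obtain ⟨v, hv⟩ := exists_tendstoUniformlyOn_of_dist_le_geometric (hd k hk)
      exact ⟨v, fun _ => hv⟩
    · exact ⟨0, fun h => absurd h hk⟩
  choose v hv using hv
  have hT : HasFTaylorSeriesUpToOn r g (fun z k => v k z) O := by
    refine ⟨fun z hz => ?_, fun m hm z hz => ?_, fun m hm => ?_⟩
    · have h1 := ((continuousMultilinearCurryFin0 ℝ E F).continuous.tendsto _).comp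
        ((hv 0 (by simp)).tendsto_at hz)
      refine tendsto_nhds_unique h1 ?_
      simpa [Function.comp_def, iteratedFDeriv_zero_eq_comp] using hfg z hz
    · have hm1 : ((m + 1 : ℕ) : ℕ∞) ≤ r := by
        have : (m : ℕ∞) < r := by exact_mod_cast hm
        exact_mod_cast Order.add_one_le_of_lt this
      have hm' : (m : ℕ∞) < r := by exact_mod_cast hm
      -- The theorem on differentiating a uniform limit wants every term differentiable, while the
      -- maps are only eventually C^r; hence the shift by N.
      obtain ⟨N, hN⟩ := eventually_atTop.1 hf
      let I := (continuousMultilinearCurryLeftEquiv ℝ (fun _ : Fin (m + 1) => E) F)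
      have hu : TendstoUniformlyOn (fun n z => I (iteratedFDeriv ℝ (m + 1) (f (n + N)) z))
          (fun z => I (v (m + 1) z)) atTop O :=
        I.isometry.uniformContinuous.comp_tendstoUniformlyOn
          (fun s hs => (tendsto_add_atTop_nat N).eventually (hv (m + 1) hm1 s hs))
      refine (hasFDerivAt_of_tendstoUniformlyOn (f := fun n => iteratedFDeriv ℝ m (f (n + N)))
        hO hu (fun n x hx => ?_)
        (fun x hx => ((hv m hm'.le).tendsto_at hx).comp (tendsto_add_atTop_nat N)) hz
        ).hasFDerivWithinAt
      have hc : ContDiffAt ℝ r (f (n + N)) x :=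
        (hN _ (Nat.le_add_left _ _)).contDiffAt (hO.mem_nhds hx)
      have := (hc.differentiableAt_iteratedFDeriv (m := m) (by exact_mod_cast hm')).hasFDerivAt
      rw [fderiv_iteratedFDeriv] at this
      exact this
    · have hm' : (m : ℕ∞) ≤ r := by exact_mod_cast hm
      refine (hv m hm').continuousOn (Eventually.frequently ?_)
      filter_upwards [hf] with n hn x hx
      have hc : ContDiffAt ℝ m (f n) x :=
        (hn.contDiffAt (hO.mem_nhds hx)).of_le (by exact_mod_cast hm')
      exact (hc.iteratedFDeriv_right (m := 0) (i := m) (by simp)).continuousAt.continuousWithinAt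
  refine ⟨hT.contDiffOn, fun k hk z hz => ?_⟩
  have h1 := hT.eq_iteratedFDerivWithin_of_uniqueDiffOn (m := k) (by exact_mod_cast hk)
    hO.uniqueDiffOn hz
  rw [iteratedFDerivWithin_of_isOpen k hO hz] at h1
  rw [← h1]
  exact (hv k hk).tendsto_at hz

end Analysis

/-! ### Product charts, and plaques inside leaves. -/

section Charts

variable {r : ℕ∞} {p q p' q' : ℕ}
  {M : Type*} [TopologicalSpace M] [ChartedSpace (Euc (p + q)) M]
  {M' : Type*} [TopologicalSpace M'] [ChartedSpace (Euc (p' + q')) M']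

theorem IsProductChart.contMDiffAt {e : OpenPartialHomeomorph M (Euc q × Euc p)}
    (he : IsProductChart r e) {x : M} (hx : x ∈ e.source) :
    ContMDiffAt 𝓘(ℝ, Euc (p + q)) 𝓘(ℝ, Euc q × Euc p) r e x :=
  he.contMDiffOn.contMDiffAt (e.open_source.mem_nhds hx)

theorem IsProductChart.contMDiffAt_symm {e : OpenPartialHomeomorph M (Euc q × Euc p)}
    (he : IsProductChart r e) {z : Euc q × Euc p} (hz : z ∈ e.target) :
    ContMDiffAt 𝓘(ℝ, Euc q × Euc p) 𝓘(ℝ, Euc (p + q)) r e.symm z :=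
  he.contMDiffOn_symm.contMDiffAt (e.open_target.mem_nhds hz)

/-- The local expression of a `C^r` map in product charts is `C^r`. -/
theorem IsProductChart.contDiffAt_comp {e : OpenPartialHomeomorph M (Euc q × Euc p)}
    (he : IsProductChart r e) {e' : OpenPartialHomeomorph M' (Euc q' × Euc p')}
    (he' : IsProductChart r e') {φ : M → M'} {x : M}
    (hφ : ContMDiffAt 𝓘(ℝ, Euc (p + q)) 𝓘(ℝ, Euc (p' + q')) r φ x)
    (hx : x ∈ e.source) (hx' : φ x ∈ e'.source) :
    ContDiffAt ℝ r (e' ∘ φ ∘ e.symm) (e x) := by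
  rw [← contMDiffAt_iff_contDiffAt]
  have h1 := he.contMDiffAt_symm (e.map_source hx)
  have h2 : ContMDiffAt 𝓘(ℝ, Euc (p + q)) 𝓘(ℝ, Euc (p' + q')) r φ (e.symm (e x)) := by
    rwa [e.left_inv hx]
  have h3 : ContMDiffAt 𝓘(ℝ, Euc (p' + q')) 𝓘(ℝ, Euc q' × Euc p') r e' (φ (e.symm (e x))) := by
    rw [e.left_inv hx]; exact he'.contMDiffAt hx'
  exact ContMDiffAt.comp (e x) h3 (h2.comp (e x) h1)

/-- A change of product charts is `C^r`. -/
theorem IsProductChart.contDiffAt_transition {e₁ e₂ : OpenPartialHomeomorph M (Euc q × Euc p)}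
    (he₁ : IsProductChart r e₁) (he₂ : IsProductChart r e₂) {x : M}
    (hx₁ : x ∈ e₁.source) (hx₂ : x ∈ e₂.source) : ContDiffAt ℝ r (e₂ ∘ e₁.symm) (e₁ x) :=
  he₁.contDiffAt_comp (φ := id) he₂ contMDiffAt_id hx₁ hx₂

/-- Two points of the same plaque lie in the same leaf. -/
theorem Foliation.mem_leaf_of_fst_eq (F : Foliation r p q M)
    {e : OpenPartialHomeomorph M (Euc q × Euc p)} (he : e ∈ F.charts) {x y : M}
    (hx : x ∈ e.source) (hy : y ∈ e.source) (hxy : (e x).1 = (e y).1) : y ∈ F.leaf x := by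
  obtain ⟨T, B, -, -, hB, hTB⟩ := (F.isProductChart e he).target_eq
  have hmem : ∀ {w}, w ∈ e.source → (e w).1 ∈ T ∧ (e w).2 ∈ B := by
    intro w hw
    have := e.map_source hw
    rwa [hTB] at this
  let γ : Euc p → M := fun b => e.symm ((e x).1, b)
  have hcont : @ContinuousOn _ _ _ F.leafTopology γ B := by
    -- It suffices to test against plaques of another chart: near each point, the transverse
    -- coordinate in that chart is a function of the first coordinate, which is constant along γ.
    -- Connectedness of the plaque then follows from convexity of B.
    refine continuousOn_to_generateFrom_iff.2 ?_
    rintro b hb _ ⟨e₂, he₂, t, -, rfl⟩ ⟨hb₁, hb₂⟩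
    have hz : ((e x).1, b) ∈ e.target := by rw [hTB]; exact ⟨(hmem hx).1, hb⟩
    have hz' : ((e x).1, b) ∈ (e.symm.trans e₂).source := by
      rw [OpenPartialHomeomorph.trans_source]; exact ⟨hz, hb₁⟩
    obtain ⟨h, hh⟩ := F.compatible e he e₂ he₂ _ hz'
    have hopen := (e.symm.trans e₂).open_source.mem_nhds hz'
    have hpair : Tendsto (fun b' : Euc p => ((e x).1, b')) (𝓝 b) (𝓝 ((e x).1, b)) :=
      (Continuous.prodMk_right (e x).1).tendsto b
    refine mem_nhdsWithin_of_mem_nhds ?_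
    filter_upwards [hpair.eventually hh, hpair.eventually hopen] with b' h1 h2
    rw [OpenPartialHomeomorph.trans_source] at h2
    exact ⟨h2.2, by rw [h1, ← hb₂, hh.self_of_nhds]⟩
  have hpre : @IsPreconnected M F.leafTopology (γ '' B) :=
    @IsPreconnected.image _ _ _ F.leafTopology _ hB.isPreconnected γ hcont
  have hxmem : x ∈ γ '' B := ⟨(e x).2, (hmem hx).2, e.left_inv hx⟩
  have hymem : y ∈ γ '' B :=
    ⟨(e y).2, (hmem hy).2, by simp only [γ]; rw [hxy]; exact e.left_inv hy⟩
  exact @IsPreconnected.subset_connectedComponent M F.leafTopology x _ hpre hxmem y hymem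

end Charts

/-! ### Basic neighbourhoods and convergence of jets. -/

section Topology

variable {r : ℕ∞} {p q p' q' : ℕ}
  {M : Type*} [TopologicalSpace M] [ChartedSpace (Euc (p + q)) M]
  {M' : Type*} [TopologicalSpace M'] [ChartedSpace (Euc (p' + q')) M']
  {F : Foliation r p q M} {F' : Foliation r p' q' M'}

theorem FoliationMap.continuous (φ : FoliationMap F F') : Continuous φ.1 := φ.2.1.continuous

theorem FoliationMap.contDiffAt (φ : FoliationMap F F')
    {e : OpenPartialHomeomorph M (Euc q × Euc p)} (he : e ∈ F.charts)
    {e' : OpenPartialHomeomorph M' (Euc q' × Euc p')} (he' : e' ∈ F'.charts) {x : M}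
    (hx : x ∈ e.source) (hx' : φ.1 x ∈ e'.source) :
    ContDiffAt ℝ r (e' ∘ φ.1 ∘ e.symm) (e x) :=
  (F.isProductChart e he).contDiffAt_comp (F'.isProductChart e' he') φ.2.1.contMDiffAt hx hx'

theorem FoliationMap.continuousOn_iteratedFDeriv (φ : FoliationMap F F')
    {e : OpenPartialHomeomorph M (Euc q × Euc p)} (he : e ∈ F.charts)
    {e' : OpenPartialHomeomorph M' (Euc q' × Euc p')} (he' : e' ∈ F'.charts) {K : Set M}
    (hK : K ⊆ e.source) (hK' : MapsTo φ.1 K e'.source) {k : ℕ} (hk : (k : ℕ∞) ≤ r) :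
    ContinuousOn (fun x => iteratedFDeriv ℝ k (e' ∘ φ.1 ∘ e.symm) (e x)) K := by
  intro x hx
  have h1 : ContDiffAt ℝ k (e' ∘ φ.1 ∘ e.symm) (e x) :=
    (φ.contDiffAt he he' (hK hx) (hK' hx)).of_le (by exact_mod_cast hk)
  have h2 : ContinuousAt (iteratedFDeriv ℝ k (e' ∘ φ.1 ∘ e.symm)) (e x) :=
    (h1.iteratedFDeriv_right (m := 0) (i := k) (by simp)).continuousAt
  exact (ContinuousAt.comp (f := e) h2 (e.continuousAt (hK hx))).continuousWithinAt

/-- The orders of differentiation used in the plaquewise topologies of `C^r` maps. -/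
def AdmissibleOrder (r : ℕ∞) (s : ℕ) : Prop := (s : ℕ∞) = r ∨ r = ⊤

theorem AdmissibleOrder.le {s : ℕ} (h : AdmissibleOrder r s) {k : ℕ} (hk : k ≤ s) :
    (k : ℕ∞) ≤ r := by
  rcases h with rfl | rfl
  · exact_mod_cast hk
  · exact le_top

theorem AdmissibleOrder.max {s t : ℕ} (hs : AdmissibleOrder r s) (ht : AdmissibleOrder r t) :
    AdmissibleOrder r (max s t) := by
  rcases max_choice s t with h | h <;> rw [h] <;> assumption

/-- Admissible orders that eventually exceed every finite order `k ≤ r`. -/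
theorem exists_admissibleOrder_seq (r : ℕ∞) : ∃ s : ℕ → ℕ, (∀ n, AdmissibleOrder r (s n)) ∧
    ∀ k : ℕ, (k : ℕ∞) ≤ r → ∀ᶠ n in atTop, k ≤ s n := by
  induction r using ENat.recTopCoe with
  | top => exact ⟨id, fun n => Or.inr rfl, fun k _ => eventually_ge_atTop k⟩
  | coe r => exact ⟨fun _ => r, fun n => Or.inl rfl,
      fun k hk => Eventually.of_forall fun _ => by exact_mod_cast hk⟩

namespace PlaqueData

variable {φ ψ : FoliationMap F F'} {ι κ : Type}

/-- The same charts and compact sets, around another map and with other radii. -/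
def recenter (D : PlaqueData φ ι) (ψ : FoliationMap F F')
    (h : ∀ i, MapsTo ψ.1 (D.K i) (D.θ' i).source) (ε : ι → ℝ) (hε : ∀ i, 0 < ε i) :
    PlaqueData ψ ι :=
  { D with ε := ε, mapsTo := h, ε_pos := hε }

theorem mem_nhd_self (D : PlaqueData φ ι) (s : ℕ) : φ ∈ D.nhd s :=
  fun i x hx => ⟨D.mapsTo i hx, rfl, fun k _ => by simpa using D.ε_pos i⟩

theorem nhd_anti (D : PlaqueData φ ι) {s t : ℕ} (h : s ≤ t) : D.nhd t ⊆ D.nhd s :=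
  fun _ hψ i x hx => ⟨(hψ i x hx).1, (hψ i x hx).2.1, fun k hk => (hψ i x hx).2.2 k (hk.trans h)⟩

theorem mapsTo_of_mem_nhd (D : PlaqueData φ ι) {s : ℕ} (h : ψ ∈ D.nhd s) (i : ι) :
    MapsTo ψ.1 (D.K i) (D.θ' i).source := fun x hx => (h i x hx).1

/-- Every element of a basic set is the centre of a smaller basic set. -/
theorem exists_recenter_nhd_subset (D : PlaqueData φ ι) {s : ℕ} (hs : AdmissibleOrder r s)
    (hψ : ψ ∈ D.nhd s) : ∃ D' : PlaqueData ψ ι, D'.nhd s ⊆ D.nhd s := by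
  have key : ∀ i, ∃ δ : ℝ, 0 < δ ∧ ∀ k ≤ s, ∀ x ∈ D.K i, δ ≤ D.ε i -
      ‖iteratedFDeriv ℝ k (D.θ' i ∘ ψ.1 ∘ (D.θ i).symm) (D.θ i x) -
        iteratedFDeriv ℝ k (D.θ' i ∘ φ.1 ∘ (D.θ i).symm) (D.θ i x)‖ := by
    intro i
    -- The remaining margin is continuous and positive on the compact set, so it has a positive
    -- lower bound; finitely many orders k then share one δ.
    have hk : ∀ k ∈ Iic s, ∀ᶠ δ : ℝ in 𝓝[>] 0, ∀ x ∈ D.K i, δ ≤ D.ε i -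
        ‖iteratedFDeriv ℝ k (D.θ' i ∘ ψ.1 ∘ (D.θ i).symm) (D.θ i x) -
          iteratedFDeriv ℝ k (D.θ' i ∘ φ.1 ∘ (D.θ i).symm) (D.θ i x)‖ := by
      intro k hk
      have hc := continuousOn_const (c := D.ε i) |>.sub
        ((ψ.continuousOn_iteratedFDeriv (D.θ_mem i) (D.θ'_mem i) (D.K_subset i)
          (D.mapsTo_of_mem_nhd hψ i) (hs.le hk)).sub
        (φ.continuousOn_iteratedFDeriv (D.θ_mem i) (D.θ'_mem i) (D.K_subset i)
          (D.mapsTo i) (hs.le hk))).norm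
      obtain ⟨a, ha, hle⟩ := (D.isCompact i).exists_forall_le' hc (a := 0)
        fun x hx => sub_pos.2 ((hψ i x hx).2.2 k hk)
      filter_upwards [Ioo_mem_nhdsGT ha] with δ hδ x hx
      exact hδ.2.le.trans (hle x hx)
    obtain ⟨δ, h1, h2⟩ := (((finite_Iic s).eventually_all.2 hk).and
      self_mem_nhdsWithin).exists
    exact ⟨δ, h2, h1⟩
  choose δ hδ hle using key
  refine ⟨D.recenter ψ (D.mapsTo_of_mem_nhd hψ) δ hδ, fun χ hχ i x hx => ?_⟩
  obtain ⟨h1, h2, h3⟩ := hχ i x hx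
  refine ⟨h1, h2.trans (hψ i x hx).2.1, fun k hk => ?_⟩
  have h4 : _ < δ i := h3 k hk
  have h5 := hle i k hk x hx
  exact (norm_sub_le_norm_sub_add_norm_sub _
    (iteratedFDeriv ℝ k (D.θ' i ∘ ψ.1 ∘ (D.θ i).symm) (D.θ i x)) _).trans_lt
    ((add_lt_add_of_lt_of_le h4 le_rfl).trans_le (by linarith))

/-- The disjoint union of two families. -/
def sum (D₁ : PlaqueData φ ι) (D₂ : PlaqueData φ κ) : PlaqueData φ (ι ⊕ κ) where
  θ := Sum.elim D₁.θ D₂.θ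
  θ' := Sum.elim D₁.θ' D₂.θ'
  K := Sum.elim D₁.K D₂.K
  ε := Sum.elim D₁.ε D₂.ε
  θ_mem := Sum.rec D₁.θ_mem D₂.θ_mem
  locallyFinite := by
    convert D₁.locallyFinite.sumElim D₂.locallyFinite using 1
    ext i
    cases i <;> rfl
  θ'_mem := Sum.rec D₁.θ'_mem D₂.θ'_mem
  isCompact := Sum.rec D₁.isCompact D₂.isCompact
  K_subset := Sum.rec D₁.K_subset D₂.K_subset
  mapsTo := Sum.rec D₁.mapsTo D₂.mapsTo
  ε_pos := Sum.rec D₁.ε_pos D₂.ε_pos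

theorem sum_nhd_subset (D₁ : PlaqueData φ ι) (D₂ : PlaqueData φ κ) (s : ℕ) :
    (D₁.sum D₂).nhd s ⊆ D₁.nhd s ∩ D₂.nhd s :=
  fun _ h => ⟨fun i => h (Sum.inl i), fun i => h (Sum.inr i)⟩

/-- The empty family. -/
def empty (φ : FoliationMap F F') : PlaqueData φ Empty where
  θ := Empty.elim
  θ' := Empty.elim
  K := Empty.elim
  ε := Empty.elim
  θ_mem := fun i => i.elim
  locallyFinite := locallyFinite_of_finite _
  θ'_mem := fun i => i.elim
  isCompact := fun i => i.elim
  K_subset := fun i => i.elim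
  mapsTo := fun i => i.elim
  ε_pos := fun i => i.elim

end PlaqueData

/-- The topology generated by the basic sets of the families whose index type satisfies `P`. -/
@[reducible] def plaquewise (P : Type → Prop) (F : Foliation r p q M) (F' : Foliation r p' q' M') :
    TopologicalSpace (FoliationMap F F') :=
  TopologicalSpace.generateFrom
    {N | ∃ (s : ℕ) (φ : FoliationMap F F') (ι : Type) (_ : P ι) (D : PlaqueData φ ι),
      AdmissibleOrder r s ∧ N = D.nhd s}

/-- A class of index types that contains the finite types and is closed under disjoint unions. -/
structure IndexClass (P : Type → Prop) : Prop where
  of_finite : ∀ ι, Finite ι → P ι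
  sum : ∀ ι κ, P ι → P κ → P (ι ⊕ κ)

variable {P : Type → Prop}

theorem isOpen_nhd {ι : Type} (hι : P ι) {φ : FoliationMap F F'} (D : PlaqueData φ ι) {s : ℕ}
    (hs : AdmissibleOrder r s) : IsOpen[plaquewise P F F'] (D.nhd s) :=
  TopologicalSpace.isOpen_generateFrom_of_mem ⟨s, φ, ι, hι, D, hs, rfl⟩

/-- The basic sets, a priori a subbase, behave as a base: recentring handles a generator, and
disjoint unions of families at the larger order handle intersections. -/
theorem exists_nhd_subset (hP : IndexClass P) {W : Set (FoliationMap F F')}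
    (hW : IsOpen[plaquewise P F F'] W) {φ : FoliationMap F F'} (hφ : φ ∈ W) :
    ∃ (s : ℕ) (ι : Type) (_ : P ι) (D : PlaqueData φ ι), AdmissibleOrder r s ∧ D.nhd s ⊆ W := by
  induction hW with
  | basic N hN =>
    obtain ⟨s, χ, ι, hι, D, hs, rfl⟩ := hN
    obtain ⟨D', hD'⟩ := D.exists_recenter_nhd_subset hs hφ
    exact ⟨s, ι, hι, D', hs, hD'⟩
  | univ =>
    obtain ⟨s, hs, -⟩ := exists_admissibleOrder_seq r
    exact ⟨s 0, Empty, hP.of_finite _ inferInstance, PlaqueData.empty φ, hs 0, subset_univ _⟩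
  | inter A B _ _ hA hB =>
    obtain ⟨s, ι, hι, D, hs, hD⟩ := hA hφ.1
    obtain ⟨t, κ, hκ, E, ht, hE⟩ := hB hφ.2
    refine ⟨max s t, ι ⊕ κ, hP.sum _ _ hι hκ, D.sum E, hs.max ht, fun χ hχ => ?_⟩
    have h := D.sum_nhd_subset E _ hχ
    exact ⟨hD (D.nhd_anti (le_max_left _ _) h.1), hE (E.nhd_anti (le_max_right _ _) h.2)⟩
  | sUnion S _ hS =>
    obtain ⟨A, hA, hφA⟩ := hφ
    obtain ⟨s, ι, hι, D, hs, hD⟩ := hS A hA hφA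
    exact ⟨s, ι, hι, D, hs, hD.trans (subset_sUnion_of_mem hA)⟩

/-- Pointwise convergence of all jets of order at most `r`, in all foliation charts. -/
def JetTendsto (φ : ℕ → FoliationMap F F') (ψ : FoliationMap F F') : Prop :=
  ∀ x, Tendsto (fun m => (φ m).1 x) atTop (𝓝 (ψ.1 x)) ∧
    ∀ e ∈ F.charts, ∀ e' ∈ F'.charts, x ∈ e.source → ψ.1 x ∈ e'.source →
      ∀ k : ℕ, (k : ℕ∞) ≤ r →
        Tendsto (fun m => iteratedFDeriv ℝ k (e' ∘ (φ m).1 ∘ e.symm) (e x)) atTop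
          (𝓝 (iteratedFDeriv ℝ k (e' ∘ ψ.1 ∘ e.symm) (e x)))

/-- To check the convergence of jets at a point, one pair of charts suffices. -/
theorem jetTendsto_of_exists_charts {φ : ℕ → FoliationMap F F'} {ψ : FoliationMap F F'}
    (hlim : ∀ x, Tendsto (fun m => (φ m).1 x) atTop (𝓝 (ψ.1 x)))
    (h : ∀ x, ∃ e ∈ F.charts, ∃ e' ∈ F'.charts, x ∈ e.source ∧ ψ.1 x ∈ e'.source ∧
      ∀ k : ℕ, (k : ℕ∞) ≤ r →
        Tendsto (fun m => iteratedFDeriv ℝ k (e' ∘ (φ m).1 ∘ e.symm) (e x)) atTop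
          (𝓝 (iteratedFDeriv ℝ k (e' ∘ ψ.1 ∘ e.symm) (e x)))) :
    JetTendsto φ ψ := by
  refine fun x => ⟨hlim x, fun e₂ he₂ e₂' he₂' hx₂ hx₂' k hk => ?_⟩
  obtain ⟨e₁, he₁, e₁', he₁', hx₁, hx₁', hjet⟩ := h x
  have hk' : (k : ℕ∞ω) ≤ r := by exact_mod_cast hk
  let g := e₂' ∘ e₁'.symm
  let f := e₁ ∘ e₂.symm
  have hfx : f (e₂ x) = e₁ x := by simp [f, e₂.left_inv hx₂]
  have hin : ∀ᶠ m in atTop, (φ m).1 x ∈ e₁'.source :=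
    (hlim x).eventually (e₁'.open_source.mem_nhds hx₁')
  have hcongr : ∀ χ : FoliationMap F F', χ.1 x ∈ e₁'.source →
      (e₂' ∘ χ.1 ∘ e₂.symm) =ᶠ[𝓝 (e₂ x)] g ∘ (e₁' ∘ χ.1 ∘ e₁.symm) ∘ f := by
    intro χ hχ
    have hc : Tendsto e₂.symm (𝓝 (e₂ x)) (𝓝 x) := by
      have := e₂.continuousAt_symm (e₂.map_source hx₂)
      rwa [ContinuousAt, e₂.left_inv hx₂] at this
    filter_upwards [hc.eventually (e₁.open_source.mem_nhds hx₁),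
      (χ.continuous.continuousAt.tendsto.comp hc).eventually (e₁'.open_source.mem_nhds hχ)]
      with z h1 h2
    simp only [Function.comp_apply, g, f] at h2 ⊢
    rw [e₁.left_inv h1, e₁'.left_inv h2]
  have hval : (e₁' ∘ ψ.1 ∘ e₁.symm) (f (e₂ x)) = e₁' (ψ.1 x) := by
    simp [hfx, e₁.left_inv hx₁]
  have hg : ContDiffAt ℝ k g ((e₁' ∘ ψ.1 ∘ e₁.symm) (f (e₂ x))) := by
    rw [hval]
    exact ((F'.isProductChart _ he₁').contDiffAt_transition (F'.isProductChart _ he₂')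
      hx₁' hx₂').of_le hk'
  have hf : ContDiffAt ℝ k f (e₂ x) := ((F.isProductChart _ he₂).contDiffAt_transition
    (F.isProductChart _ he₁) hx₂ hx₁).of_le hk'
  rw [(hcongr ψ hx₁').iteratedFDeriv ℝ k |>.self_of_nhds]
  refine (tendsto_iteratedFDeriv_comp_comp (f := fun m => e₁' ∘ (φ m).1 ∘ e₁.symm) hg hf
    ?_ ?_ ?_).congr' ?_
  · filter_upwards [hin] with m hm
    rw [hfx]
    exact ((φ m).contDiffAt he₁ he₁' hx₁ hm).of_le hk'
  · rw [hfx]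
    exact (ψ.contDiffAt he₁ he₁' hx₁ hx₁').of_le hk'
  · intro j hj
    rw [hfx]
    exact hjet j (le_trans (by exact_mod_cast hj) hk)
  · filter_upwards [hin] with m hm
    exact ((hcongr (φ m) hm).iteratedFDeriv ℝ k).self_of_nhds.symm

end Topology

/-! ### Neighbourhoods closed under limits, limits of sequences, and the construction. -/

section Baire

variable {r : ℕ∞} {p q p' q' : ℕ}
  {M : Type*} [TopologicalSpace M] [ChartedSpace (Euc (p + q)) M]
  {M' : Type*} [TopologicalSpace M'] [ChartedSpace (Euc (p' + q')) M']
  {F : Foliation r p q M} {F' : Foliation r p' q' M'} {P : Type → Prop}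

theorem norm_iteratedFDeriv_zero_sub {E G : Type*} [NormedAddCommGroup E] [NormedSpace ℝ E]
    [NormedAddCommGroup G] [NormedSpace ℝ G] (f g : E → G) (z : E) :
    ‖iteratedFDeriv ℝ 0 f z - iteratedFDeriv ℝ 0 g z‖ = ‖f z - g z‖ := by
  rw [iteratedFDeriv_zero_eq_comp, iteratedFDeriv_zero_eq_comp]
  simp only [Function.comp_apply]
  rw [← map_sub, LinearIsometryEquiv.norm_map]

/-- A compact set has a closed thickening inside any open set containing it. The radius turns
closeness of order 0 in a chart into control of where values lie. -/
theorem OpenPartialHomeomorph.exists_closedBall_subset {X Y E : Type*} [TopologicalSpace X]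
    [TopologicalSpace Y] [PseudoMetricSpace E] (e : OpenPartialHomeomorph Y E) {φ : X → Y}
    (hφ : Continuous φ) {K : Set X} (hK : IsCompact K) {O : Set Y} (hO : IsOpen O)
    (hOe : O ⊆ e.source) (hKO : MapsTo φ K O) :
    ∃ ρ > 0, ∀ x ∈ K, Metric.closedBall (e (φ x)) ρ ⊆ e.target ∩ e.symm ⁻¹' O := by
  have hc : IsCompact ((e ∘ φ) '' K) := hK.image_of_continuousOn
    (e.continuousOn.comp hφ.continuousOn fun x hx => hOe (hKO hx))
  have hsub : (e ∘ φ) '' K ⊆ e.target ∩ e.symm ⁻¹' O := by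
    rintro _ ⟨x, hx, rfl⟩
    refine ⟨e.map_source (hOe (hKO hx)), ?_⟩
    simpa [e.left_inv (hOe (hKO hx))] using hKO hx
  obtain ⟨ρ, hρ, h⟩ := hc.exists_cthickening_subset_open (e.isOpen_inter_preimage_symm hO) hsub
  exact ⟨ρ, hρ, fun x hx =>
    (Metric.closedBall_subset_cthickening (mem_image_of_mem _ hx) ρ).trans h⟩

/-- Every neighbourhood contains a smaller one whose limits, in the sense of pointwise convergence
of jets, remain in the given neighbourhood. -/
theorem exists_isOpen_jetTendsto_mem [T2Space M'] (hP : IndexClass P)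
    {W : Set (FoliationMap F F')} (hW : IsOpen[plaquewise P F F'] W) {φ : FoliationMap F F'}
    (hφ : φ ∈ W) : ∃ V, IsOpen[plaquewise P F F'] V ∧ φ ∈ V ∧ V ⊆ W ∧
      ∀ (χ : ℕ → FoliationMap F F') (ψ : FoliationMap F F'), (∀ᶠ m in atTop, χ m ∈ V) →
        JetTendsto χ ψ → ψ ∈ W := by
  obtain ⟨s, ι, hι, D, hs, hD⟩ := exists_nhd_subset hP hW hφ
  choose ρ hρ hball using fun i => (D.θ' i).exists_closedBall_subset φ.continuous (D.isCompact i)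
    (D.θ' i).open_source subset_rfl (D.mapsTo i)
  -- Halving keeps the inequalities strict in the limit; ρ confines values to a compact piece of the
  -- chart domain, so that limits do not leave it.
  let ε : ι → ℝ := fun i => min (D.ε i / 2) (ρ i)
  have hε : ∀ i, 0 < ε i := fun i => lt_min (half_pos (D.ε_pos i)) (hρ i)
  let D' := D.recenter φ D.mapsTo ε hε
  refine ⟨D'.nhd s, isOpen_nhd hι D' hs, D'.mem_nhd_self s, fun χ hχ => hD fun i x hx => ?_,
    fun χ ψ hχ hlim => hD fun i x hx => ?_⟩
  · obtain ⟨h1, h2, h3⟩ := hχ i x hx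
    refine ⟨h1, h2, fun k hk => (h3 k hk).trans_le ((min_le_left _ _).trans ?_)⟩
    linarith [D.ε_pos i]
  · have hxe := D.K_subset i hx
    have hB : ∀ᶠ m in atTop, (χ m).1 x ∈
        (D.θ' i).symm '' Metric.closedBall (D.θ' i (φ.1 x)) (ρ i) := by
      filter_upwards [hχ] with m hm
      obtain ⟨h1, -, h3⟩ := hm i x hx
      refine ⟨D.θ' i ((χ m).1 x), ?_, (D.θ' i).left_inv h1⟩
      have h0 := h3 0 (Nat.zero_le _)
      rw [norm_iteratedFDeriv_zero_sub] at h0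
      have h0' : ‖D.θ' i ((χ m).1 ((D.θ i).symm (D.θ i x))) -
        D.θ' i (φ.1 ((D.θ i).symm (D.θ i x)))‖ < ε i := h0
      rw [(D.θ i).left_inv hxe] at h0'
      rw [Metric.mem_closedBall, dist_eq_norm]
      exact h0'.le.trans (min_le_right _ _)
    have hclosed : IsClosed
        ((D.θ' i).symm '' Metric.closedBall (D.θ' i (φ.1 x)) (ρ i)) :=
      ((isCompact_closedBall _ _).image_of_continuousOn ((D.θ' i).continuousOn_symm.mono
        fun z hz => (hball i x hx hz).1)).isClosed
    have hψ : ψ.1 x ∈ (D.θ' i).source := by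
      obtain ⟨z, hz, hzx⟩ := hclosed.mem_of_tendsto (hlim x).1 hB
      rw [← hzx]
      exact (D.θ' i).map_target (hball i x hx hz).1
    refine ⟨hψ, ?_, fun k hk => ?_⟩
    · have h1 : Tendsto (fun m => (D.θ' i ((χ m).1 x)).1) atTop (𝓝 (D.θ' i (ψ.1 x)).1) :=
        (continuous_fst.tendsto _).comp
          (((D.θ' i).continuousAt hψ).tendsto.comp (hlim x).1)
      refine tendsto_nhds_unique h1 (tendsto_const_nhds.congr' ?_)
      filter_upwards [hχ] with m hm
      exact (hm i x hx).2.1.symm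
    · have h1 := (((hlim x).2 _ (D.θ_mem i) _ (D.θ'_mem i) hxe hψ k (hs.le hk)).sub_const
        (iteratedFDeriv ℝ k (D.θ' i ∘ φ.1 ∘ (D.θ i).symm) (D.θ i x))).norm
      have h2 : _ ≤ D.ε i / 2 := le_of_tendsto h1 (by
        filter_upwards [hχ] with m hm
        exact ((hm i x hx).2.2 k hk).le.trans (min_le_left _ _))
      exact h2.trans_lt (half_lt_self (D.ε_pos i))

/-- A pair of foliation charts together with compact subsets of their domains. -/
structure ChartPair (F : Foliation r p q M) (F' : Foliation r p' q' M') where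
  e : OpenPartialHomeomorph M (Euc q × Euc p)
  e' : OpenPartialHomeomorph M' (Euc q' × Euc p')
  K : Set M
  C : Set M'
  e_mem : e ∈ F.charts
  e'_mem : e' ∈ F'.charts
  isCompact_K : IsCompact K
  K_subset : K ⊆ e.source
  isCompact_C : IsCompact C
  C_subset : C ⊆ e'.source

namespace ChartPair

/-- The map `φ` sends `K` into the interior of `C`. -/
def Good (c : ChartPair F F') (φ : FoliationMap F F') : Prop := MapsTo φ.1 c.K (interior c.C)

/-- On `K`, the maps `φ` and `χ` lie in the same plaques, and their derivatives up to order `s`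
are `δ`-close. -/
def Close (c : ChartPair F F') (s : ℕ) (δ : ℝ) (φ χ : FoliationMap F F') : Prop :=
  ∀ x ∈ c.K, (c.e' (χ.1 x)).1 = (c.e' (φ.1 x)).1 ∧ ∀ k ≤ s,
    dist (iteratedFDeriv ℝ k (c.e' ∘ φ.1 ∘ c.e.symm) (c.e x))
      (iteratedFDeriv ℝ k (c.e' ∘ χ.1 ∘ c.e.symm) (c.e x)) ≤ δ

/-- A single pair of charts is a finite family, hence allowed in both topologies. `Good` uses the
interior of C so that it persists nearby. -/
theorem exists_isOpen_close (c : ChartPair F F') (hP : IndexClass P) {φ : FoliationMap F F'}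
    (hφ : c.Good φ) {s : ℕ} (hs : AdmissibleOrder r s) {δ : ℝ} (hδ : 0 < δ) :
    ∃ V, IsOpen[plaquewise P F F'] V ∧ φ ∈ V ∧ ∀ χ ∈ V, c.Good χ ∧ c.Close s δ φ χ := by
  have hint : interior c.C ⊆ c.e'.source := interior_subset.trans c.C_subset
  obtain ⟨ρ, hρ, hball⟩ := c.e'.exists_closedBall_subset φ.continuous c.isCompact_K
    isOpen_interior hint hφ
  let D : PlaqueData φ Unit :=
    { θ := fun _ => c.e
      θ' := fun _ => c.e'
      K := fun _ => c.K
      ε := fun _ => min δ ρ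
      θ_mem := fun _ => c.e_mem
      locallyFinite := locallyFinite_of_finite _
      θ'_mem := fun _ => c.e'_mem
      isCompact := fun _ => c.isCompact_K
      K_subset := fun _ => c.K_subset
      mapsTo := fun _ x hx => hint (hφ hx)
      ε_pos := fun _ => lt_min hδ hρ }
  refine ⟨D.nhd s, isOpen_nhd (hP.of_finite _ inferInstance) D hs, D.mem_nhd_self s,
    fun χ hχ => ⟨fun x hx => ?_, fun x hx => ?_⟩⟩
  · obtain ⟨h1, -, h3⟩ := hχ () x hx
    have h0 := h3 0 (Nat.zero_le _)
    rw [norm_iteratedFDeriv_zero_sub] at h0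
    have h0' : ‖c.e' (χ.1 (c.e.symm (c.e x))) - c.e' (φ.1 (c.e.symm (c.e x)))‖ < min δ ρ := h0
    rw [c.e.left_inv (c.K_subset hx), ← dist_eq_norm] at h0'
    have h4 := (hball x hx (Metric.mem_closedBall.2 (h0'.le.trans (min_le_right _ _)))).2
    rw [mem_preimage, c.e'.left_inv h1] at h4
    exact h4
  · obtain ⟨-, h2, h3⟩ := hχ () x hx
    refine ⟨h2, fun k hk => ?_⟩
    rw [dist_comm, dist_eq_norm]
    exact (h3 k hk).le.trans (min_le_left _ _)

theorem exists_finite_cover [LocallyCompactSpace M] [LocallyCompactSpace M']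
    (φ : FoliationMap F F') {A : Set M} (hA : IsCompact A) :
    ∃ L : Set (ChartPair F F'), L.Finite ∧ (∀ c ∈ L, c.Good φ) ∧
      ∀ x ∈ A, ∃ c ∈ L, c.K ∈ 𝓝 x := by
  have h : ∀ x, ∃ c : ChartPair F F', c.Good φ ∧ c.K ∈ 𝓝 x := by
    intro x
    obtain ⟨e, he, hx⟩ := F.covers x
    obtain ⟨e', he', hx'⟩ := F'.covers (φ.1 x)
    obtain ⟨C, hC, hCe, hCc⟩ := local_compact_nhds (e'.open_source.mem_nhds hx')
    have hn : φ.1 ⁻¹' interior C ∈ 𝓝 x :=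
      φ.continuous.continuousAt (interior_mem_nhds.2 hC)
    obtain ⟨K, hK, hKe, hKc⟩ := local_compact_nhds (inter_mem (e.open_source.mem_nhds hx) hn)
    exact ⟨⟨e, e', K, C, he, he', hKc, fun y hy => (hKe hy).1, hCc, hCe⟩,
      fun y hy => (hKe hy).2, hK⟩
  choose c hgood hc using h
  obtain ⟨t, -, ht⟩ := hA.elim_nhds_subcover (fun x => interior (c x).K)
    fun x _ => interior_mem_nhds.2 (hc x)
  refine ⟨c '' t, t.finite_toSet.image c, ?_, fun x hx => ?_⟩
  · rintro _ ⟨y, -, rfl⟩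
    exact hgood y
  · obtain ⟨y, hy, hxy⟩ := mem_iUnion₂.1 (ht hx)
    exact ⟨c y, mem_image_of_mem c hy, mem_interior_iff_mem_nhds.1 hxy⟩

end ChartPair

theorem Foliation.leaf_eq_of_mem (F : Foliation r p q M) {x y : M} (h : y ∈ F.leaf x) :
    F.leaf x = F.leaf y :=
  @connectedComponent_eq M F.leafTopology _ _ h

theorem Foliation.mem_leaf_self (F : Foliation r p q M) (x : M) : x ∈ F.leaf x :=
  @mem_connectedComponent M F.leafTopology x

/-- A sequence of maps that is locally geometrically Cauchy, with eventually constant plaques, has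
a limit in `C^r(F, F')`. -/
theorem exists_jetTendsto [T2Space M'] {φ : ℕ → FoliationMap F F'} {s : ℕ → ℕ}
    (hs : ∀ k : ℕ, (k : ℕ∞) ≤ r → ∀ᶠ n in atTop, k ≤ s n)
    (h : ∀ x, ∃ c : ChartPair F F', c.K ∈ 𝓝 x ∧
      ∀ᶠ m in atTop, c.Good (φ m) ∧ c.Close (s m) ((1 / 2) ^ m) (φ m) (φ (m + 1))) :
    ∃ ψ, JetTendsto φ ψ := by
  choose c hK hgc using h
  have hC : ∀ a, ∀ᶠ m in atTop, ∀ x ∈ (c a).K, (φ m).1 x ∈ (c a).C := fun a => by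
    filter_upwards [hgc a] with m hm x hx using interior_subset (hm.1 hx)
  have hdist : ∀ a, ∀ k : ℕ, (k : ℕ∞) ≤ r → ∀ᶠ m in atTop, ∀ x ∈ (c a).K,
      dist (iteratedFDeriv ℝ k ((c a).e' ∘ (φ m).1 ∘ (c a).e.symm) ((c a).e x))
        (iteratedFDeriv ℝ k ((c a).e' ∘ (φ (m + 1)).1 ∘ (c a).e.symm) ((c a).e x))
          ≤ (1 / 2 : ℝ) ^ m := fun a k hk => by
    filter_upwards [hgc a, hs k hk] with m hm hsm x hx using (hm.2 x hx).2 k hsm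
  have hlim : ∀ x, ∃ y, Tendsto (fun m => (φ m).1 x) atTop (𝓝 y) := by
    intro x
    have hx := mem_of_mem_nhds (hK x)
    have hd : ∀ᶠ m in atTop, ∀ z ∈ ({x} : Set M),
        dist ((c x).e' ((φ m).1 z)) ((c x).e' ((φ (m + 1)).1 z)) ≤ (1 / 2 : ℝ) ^ m := by
      filter_upwards [hdist x 0 (by simp)] with m hm z hz
      obtain rfl : z = x := hz
      have := hm z hx
      rw [dist_eq_norm, norm_iteratedFDeriv_zero_sub, ← dist_eq_norm] at this
      simpa [(c z).e.left_inv ((c z).K_subset hx)] using this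
    obtain ⟨v, hv⟩ := exists_tendstoUniformlyOn_of_dist_le_geometric hd
    have hv := hv.tendsto_at (mem_singleton x)
    -- Compactness of C prevents the limit in coordinates from escaping the target of the chart.
    have hcl : IsClosed ((c x).e' '' (c x).C) := ((c x).isCompact_C.image_of_continuousOn
      ((c x).e'.continuousOn.mono (c x).C_subset)).isClosed
    obtain ⟨y, hy, hyv⟩ := hcl.mem_of_tendsto hv
      ((hC x).mono fun m hm => mem_image_of_mem _ (hm x hx))
    have hyt : v x ∈ (c x).e'.target := hyv ▸ (c x).e'.map_source ((c x).C_subset hy)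
    refine ⟨(c x).e'.symm (v x),
      (((c x).e'.continuousAt_symm hyt).tendsto.comp hv).congr' ?_⟩
    filter_upwards [hC x] with m hm
    exact (c x).e'.left_inv ((c x).C_subset (hm x hx))
  choose ψ hψ using hlim
  have hψC : ∀ a, MapsTo ψ (c a).K (c a).C := fun a x hx =>
    (c a).isCompact_C.isClosed.mem_of_tendsto (hψ x) ((hC a).mono fun m hm => hm x hx)
  let O : M → Set (Euc q × Euc p) := fun a => (c a).e.target ∩ (c a).e.symm ⁻¹' interior (c a).K
  have hO : ∀ a, IsOpen (O a) := fun a => (c a).e.isOpen_inter_preimage_symm isOpen_interior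
  have hOK : ∀ a, ∀ z ∈ O a, (c a).e.symm z ∈ (c a).K := fun a z hz => interior_subset hz.2
  have haO : ∀ a, (c a).e a ∈ O a := fun a => by
    have ha := (c a).K_subset (mem_of_mem_nhds (hK a))
    refine ⟨(c a).e.map_source ha, ?_⟩
    rw [mem_preimage, (c a).e.left_inv ha]
    exact mem_interior_iff_mem_nhds.2 (hK a)
  have hmain := fun a => contDiffOn_of_dist_iteratedFDeriv_le_geometric (r := r) (hO a)
    (f := fun m => (c a).e' ∘ (φ m).1 ∘ (c a).e.symm) (g := (c a).e' ∘ ψ ∘ (c a).e.symm)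
    (by
      filter_upwards [hC a] with m hm z hz
      have := (φ m).contDiffAt (c a).e_mem (c a).e'_mem ((c a).e.map_target hz.1)
        ((c a).C_subset (hm _ (hOK a z hz)))
      rw [(c a).e.right_inv hz.1] at this
      exact this.contDiffWithinAt)
    (fun z hz => ((c a).e'.continuousAt ((c a).C_subset (hψC a (hOK a z hz)))).tendsto.comp
      (hψ _))
    (fun k hk => by
      filter_upwards [hdist a k hk] with m hm z hz
      have := hm _ (hOK a z hz)
      rwa [(c a).e.right_inv hz.1] at this)
  have hsmooth : ContMDiff 𝓘(ℝ, Euc (p + q)) 𝓘(ℝ, Euc (p' + q')) r ψ := by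
    intro a
    have ha := (c a).K_subset (mem_of_mem_nhds (hK a))
    have hval : ((c a).e' ∘ ψ ∘ (c a).e.symm) ((c a).e a) = (c a).e' (ψ a) := by
      simp [(c a).e.left_inv ha]
    have h1 := (F.isProductChart _ (c a).e_mem).contMDiffAt ha
    have h2 : ContMDiffAt 𝓘(ℝ, Euc q × Euc p) 𝓘(ℝ, Euc q' × Euc p') r
        ((c a).e' ∘ ψ ∘ (c a).e.symm) ((c a).e a) :=
      contMDiffAt_iff_contDiffAt.2 ((hmain a).1.contDiffAt ((hO a).mem_nhds (haO a)))
    have h3 : ContMDiffAt 𝓘(ℝ, Euc q' × Euc p') 𝓘(ℝ, Euc (p' + q')) r (c a).e'.symm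
        (((c a).e' ∘ ψ ∘ (c a).e.symm) ((c a).e a)) := by
      rw [hval]
      exact (F'.isProductChart _ (c a).e'_mem).contMDiffAt_symm
        ((c a).e'.map_source ((c a).C_subset (hψC a (mem_of_mem_nhds (hK a)))))
    refine (ContMDiffAt.comp a h3 (h2.comp a h1)).congr_of_eventuallyEq ?_
    filter_upwards [hK a] with x hx
    simp only [Function.comp_apply]
    rw [(c a).e.left_inv ((c a).K_subset hx), (c a).e'.left_inv ((c a).C_subset (hψC a hx))]
  -- The transverse coordinate of the images of x is eventually constant, so the limit lies in the
  -- same plaque.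
  have hleaf : ∀ x, ∀ᶠ m in atTop, F'.leaf ((φ m).1 x) = F'.leaf (ψ x) := by
    intro x
    have hx := mem_of_mem_nhds (hK x)
    obtain ⟨N, hN⟩ := eventually_atTop.1 (hgc x)
    have hconst : ∀ m ≥ N, ((c x).e' ((φ m).1 x)).1 = ((c x).e' ((φ N).1 x)).1 := by
      intro m hm
      induction m, hm using Nat.le_induction with
      | base => rfl
      | succ m hm ih => exact ((hN m hm).2 x hx).1.trans ih
    have hl : Tendsto (fun m => ((c x).e' ((φ m).1 x)).1) atTop (𝓝 ((c x).e' (ψ x)).1) :=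
      (continuous_fst.tendsto _).comp
        (((c x).e'.continuousAt ((c x).C_subset (hψC x hx))).tendsto.comp (hψ x))
    have heq : ((c x).e' (ψ x)).1 = ((c x).e' ((φ N).1 x)).1 :=
      tendsto_nhds_unique hl (tendsto_const_nhds.congr'
        ((eventually_ge_atTop N).mono fun m hm => (hconst m hm).symm))
    filter_upwards [eventually_ge_atTop N, hC x] with m hm hCm
    exact F'.leaf_eq_of_mem (F'.mem_leaf_of_fst_eq (c x).e'_mem ((c x).C_subset (hCm x hx))
      ((c x).C_subset (hψC x hx)) ((hconst m hm).trans heq.symm))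
  refine ⟨⟨ψ, hsmooth, ?_⟩, jetTendsto_of_exists_charts hψ fun a => ?_⟩
  · rintro x _ ⟨y, hy, rfl⟩
    -- A single m serves both points, and φ m already preserves leaves.
    obtain ⟨m, hmx, hmy⟩ := ((hleaf x).and (hleaf y)).exists
    rw [← hmx, F'.leaf_eq_of_mem ((φ m).2.2 x (mem_image_of_mem _ hy)), hmy]
    exact F'.mem_leaf_self _
  · exact ⟨(c a).e, (c a).e_mem, (c a).e', (c a).e'_mem,
      (c a).K_subset (mem_of_mem_nhds (hK a)), (c a).C_subset (hψC a (mem_of_mem_nhds (hK a))),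
      fun k hk => (hmain a).2 k hk _ (haO a)⟩

theorem baireSpace_plaquewise [T2Space M'] [LocallyCompactSpace M] [SigmaCompactSpace M]
    [LocallyCompactSpace M'] (hP : IndexClass P) :
    @BaireSpace (FoliationMap F F') (plaquewise P F F') := by
  let : TopologicalSpace (FoliationMap F F') := plaquewise P F F'
  refine ⟨fun A hAo hAd => dense_iff_inter_open.2 fun U hU => ?_⟩
  rintro ⟨φ₀, hφ₀⟩
  obtain ⟨s, hs, hslim⟩ := exists_admissibleOrder_seq r
  let κ : CompactExhaustion M := CompactExhaustion.choice M
  -- A stage records the current map, the open set that confines later maps, and the chart pairs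
  -- under control. Finiteness of the last keeps closeness on all of them a neighbourhood condition.
  let State := {S : FoliationMap F F' × Set (FoliationMap F F') × Set (ChartPair F F') //
    S.1 ∈ S.2.1 ∧ IsOpen S.2.1 ∧ S.2.2.Finite ∧ ∀ c ∈ S.2.2, c.Good S.1}
  have step : ∀ (n : ℕ) (S : State), ∃ S' : State,
      S'.1.2.1 ⊆ S.1.2.1 ∧ S.1.2.2 ⊆ S'.1.2.2 ∧
      (∀ c ∈ S.1.2.2, c.Close (s n) ((1 / 2) ^ n) S.1.1 S'.1.1) ∧
      (∀ x ∈ κ n, ∃ c ∈ S'.1.2.2, c.K ∈ 𝓝 x) ∧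
      ∀ (χ : ℕ → FoliationMap F F') (ψ : FoliationMap F F'), (∀ᶠ m in atTop, χ m ∈ S'.1.2.1) →
        JetTendsto χ ψ → ψ ∈ S.1.2.1 ∩ A n := by
    rintro n ⟨⟨φ, V, L⟩, hφV, hV, hL, hLφ⟩
    simp only at hφV hV hL hLφ
    have hnear : ∀ c ∈ L, ∀ᶠ χ in 𝓝 φ, c.Good χ ∧ c.Close (s n) ((1 / 2) ^ n) φ χ := by
      intro c hc
      obtain ⟨Vc, hVc, hφc, h⟩ := c.exists_isOpen_close hP (hLφ c hc) (hs n)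
        (δ := (1 / 2) ^ n) (by positivity)
      exact mem_of_superset (hVc.mem_nhds hφc) h
    obtain ⟨φ', hφ'A, hφ'c, hφ'V⟩ := (hAd n).inter_nhds_nonempty
      ((hL.eventually_all.2 hnear).and (hV.mem_nhds hφV))
    obtain ⟨V', hV', hφV', hsub, hlim⟩ := exists_isOpen_jetTendsto_mem hP
      (hV.inter (hAo n)) (φ := φ') ⟨hφ'V, hφ'A⟩
    obtain ⟨L', hL', hLφ', hcov⟩ := ChartPair.exists_finite_cover φ' (κ.isCompact n)
    refine ⟨⟨⟨φ', V', L ∪ L'⟩, hφV', hV', hL.union hL', ?_⟩, fun χ h => (hsub h).1,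
      subset_union_left, fun c hc => (hφ'c c hc).2, fun x hx => ?_, hlim⟩
    · rintro c (hc | hc)
      · exact (hφ'c c hc).1
      · exact hLφ' c hc
    · obtain ⟨c, hc, hcx⟩ := hcov x hx
      exact ⟨c, Or.inr hc, hcx⟩
  choose next hnext using step
  let S : ℕ → State := Nat.rec ⟨(φ₀, U, ∅), hφ₀, hU, finite_empty, by simp⟩ next
  have hS := fun n => hnext n (S n)
  have hanti : Antitone fun n => (S n).1.2.1 := antitone_nat_of_succ_le fun n => (hS n).1
  have hmono : Monotone fun n => (S n).1.2.2 := monotone_nat_of_le_succ fun n => (hS n).2.1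
  obtain ⟨ψ, hψ⟩ := exists_jetTendsto (φ := fun n => (S n).1.1) hslim fun x => by
    obtain ⟨n, hn⟩ := κ.exists_mem x
    obtain ⟨c, hc, hcx⟩ := (hS n).2.2.2.1 x hn
    refine ⟨c, hcx, ?_⟩
    -- Stage n + 1 is the one that covers κ n, and chart pairs are never dropped afterwards.
    filter_upwards [eventually_ge_atTop (n + 1)] with m hm
    have hcm : c ∈ (S m).1.2.2 := hmono hm hc
    exact ⟨(S m).2.2.2.2 c hcm, (hS m).2.2.1 c hcm⟩
  have hψn : ∀ n, ψ ∈ (S n).1.2.1 ∩ A n := fun n =>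
    (hS n).2.2.2.2 _ ψ ((eventually_ge_atTop (n + 1)).mono fun m hm =>
      hanti hm (S m).2.1) hψ
  exact ⟨ψ, (hψn 0).1, mem_iInter.2 fun n => (hψn n).2⟩

end Baire

theorem mainTheorem6 (r : ℕ∞) (p q p' q' : ℕ)
    (M : Type*) [TopologicalSpace M] [T2Space M] [SecondCountableTopology M]
    [ChartedSpace (Euc (p + q)) M] [IsManifold 𝓘(ℝ, Euc (p + q)) r M]
    (M' : Type*) [TopologicalSpace M'] [T2Space M'] [SecondCountableTopology M']
    [ChartedSpace (Euc (p' + q')) M'] [IsManifold 𝓘(ℝ, Euc (p' + q')) r M']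
    (F : Foliation r p q M) (F' : Foliation r p' q' M') :
    @BaireSpace (FoliationMap F F') (weakPlaquewise F F') ∧
      @BaireSpace (FoliationMap F F') (strongPlaquewise F F') := by
  have : LocallyCompactSpace M := ChartedSpace.locallyCompactSpace (Euc (p + q)) M
  have : LocallyCompactSpace M' := ChartedSpace.locallyCompactSpace (Euc (p' + q')) M'
  refine ⟨baireSpace_plaquewise (P := fun ι => Finite ι)
    ⟨fun _ h => h, fun _ _ _ _ => inferInstance⟩, ?_⟩
  have hstrong : strongPlaquewise F F' = plaquewise (fun _ => True) F F' := by
    simp [strongPlaquewise, plaquewise, AdmissibleOrder]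
  rw [hstrong]
  exact baireSpace_plaquewise ⟨fun _ _ => trivial, fun _ _ _ _ => trivial⟩
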